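/- Let $r>0$, let $B_r\subset\mathbb R^2$ be the disk of radius $r$ centered at the origin, and let $f:[0,\infty)\to(0,\infty)$ be a nonincreasing function of class $C^1$. Then there is a constant $C$, depending only on $r$ and $f$, with the following property. Let $(E_h)_{h\in\mathbb N}$ be any sequence of convex subsets of $\mathbb R^2$ that converges to $B_r$ in the Hausdorff distance $d_{\mathcal H}$. Then for all sufficiently large $h$ the function $x\mapsto f(|x|)$ is $\mu_{E_h}$-integrable on $\partial E_h$ and \[ \left|\int_{\partial E_h} f(|x|)\,d\mu_{E_h}-\int_{\partial B_r} f(|x|)\,H_{\partial B_r}\,d\mathcal H^1\right|\le C\,d_{\mathcal H}(E_h,B_r). \] Here $H_{\partial B_r}=\operatorname{div}_\tau\nu_{\partial B_r}$ is the curvature of $\partial B_r$ (the tangential divergence of the exterior unit normal), $\mathcal H^1$ is the one-dimensional Hausdorff measure, and, for a bounded convex set $E\subset\mathbb R^2$, $\mu_E$ is its curvature measure: the Borel measure for which $\mu_E(\beta)$ is the $\mathcal H^1$-measure of the set of unit vectors $u$ that are outer normals of $E$ at some point $x\in\beta\cap\partial E$, i.e. $\langle u,y-x\rangle\le 0$ for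 all $y\in E$. (For $E$ of class $C^2$ with nonempty interior, $\mu_E$ is $H_{\partial E}\,\mathcal H^1$ restricted to $\partial E$.) -/

import Mathlib

open MeasureTheory Set Filter Topology Metric

/-- The Euclidean plane. -/
abbrev Plane : Type := EuclideanSpace ℝ (Fin 2)

/-- The (generalized) Gauss image of `β` for the set `E`: all unit vectors that are outer normal
vectors of `E` at some boundary point of `E` belonging to `β`. -/
def gaussImage (E β : Set Plane) : Set Plane :=
  {u | ‖u‖ = 1 ∧ ∃ x ∈ β ∩ frontier E, ∀ y ∈ E, inner ℝ u (y - x) ≤ 0}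

/-- The unit vectors that are normal to `E` at two different boundary points. -/
def multiNormals (E : Set Plane) : Set Plane :=
  {u | ‖u‖ = 1 ∧ ∃ x ∈ frontier E, ∃ x' ∈ frontier E, x ≠ x' ∧
    (∀ y ∈ E, inner ℝ u (y - x) ≤ 0) ∧ (∀ y ∈ E, inner ℝ u (y - x') ≤ 0)}

/-- The unit vector with polar angle `θ`. -/
noncomputable def polarDir (θ : ℝ) : Plane := !₂[Real.cos θ, Real.sin θ]

theorem inner_polarDir (θ : ℝ) (x : Plane) :
    inner ℝ (polarDir θ) x = Real.cos θ * x 0 + Real.sin θ * x 1 := by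
  simp [polarDir, PiLp.inner_apply, Fin.sum_univ_two, mul_comm]

theorem norm_polarDir (θ : ℝ) : ‖polarDir θ‖ = 1 := by
  simp [polarDir, EuclideanSpace.norm_eq, Fin.sum_univ_two]

theorem hasDerivAt_polarDir (θ : ℝ) :
    HasDerivAt polarDir (!₂[-Real.sin θ, Real.cos θ] : Plane) θ := by
  have h : HasDerivAt (fun t : ℝ => ![Real.cos t, Real.sin t]) ![-Real.sin θ, Real.cos θ] θ := by
    rw [hasDerivAt_pi]
    intro i
    fin_cases i
    · simpa using Real.hasDerivAt_cos θ
    · simpa using Real.hasDerivAt_sin θ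
  exact (PiLp.continuousLinearEquiv 2 ℝ (fun _ : Fin 2 => ℝ)).symm.hasFDerivAt.comp_hasDerivAt θ h

theorem lipschitz_polarDir : LipschitzWith 1 polarDir := by
  refine lipschitzWith_of_nnnorm_deriv_le (fun θ => (hasDerivAt_polarDir θ).differentiableAt) ?_
  intro θ
  rw [(hasDerivAt_polarDir θ).deriv, ← NNReal.coe_le_coe]
  simp [EuclideanSpace.norm_eq, Fin.sum_univ_two]

theorem exists_polarDir {u : Plane} (hu : ‖u‖ = 1) : ∃ θ, polarDir θ = u := by
  have h : (u 0) ^ 2 + (u 1) ^ 2 = 1 := by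
    have := EuclideanSpace.norm_sq_eq u
    rw [hu] at this
    simpa [Fin.sum_univ_two] using this.symm
  have hz : ‖(⟨u 0, u 1⟩ : ℂ)‖ = 1 := by
    rw [Complex.norm_def, Complex.normSq_mk, ← sq, ← sq, h, Real.sqrt_one]
  have hne : (⟨u 0, u 1⟩ : ℂ) ≠ 0 := by
    intro h0
    rw [h0] at hz
    simp at hz
  refine ⟨Complex.arg ⟨u 0, u 1⟩, ?_⟩
  ext i
  fin_cases i
  · simp [polarDir, Complex.cos_arg hne, hz]
  · simp [polarDir, Complex.sin_arg, hz]

/-- The support function in polar angle is Lipschitz on a bounded set. -/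
theorem lipschitz_support {E : Set Plane} (hE : Bornology.IsBounded E) (hne : E.Nonempty) :
    ∃ K, LipschitzWith K (fun θ : ℝ => ⨆ y : E, inner ℝ (polarDir θ) (y : Plane)) := by
  obtain ⟨R, hR⟩ := hE.exists_norm_le
  have := hne.to_subtype
  have hR0 : 0 ≤ R := (norm_nonneg _).trans (hR _ hne.some_mem)
  have bdd : ∀ θ, BddAbove (range fun y : E => inner ℝ (polarDir θ) (y : Plane)) := by
    intro θ
    refine ⟨R, ?_⟩
    rintro _ ⟨y, rfl⟩
    refine (real_inner_le_norm _ _).trans ?_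
    rw [norm_polarDir, one_mul]
    exact hR _ y.2
  refine ⟨⟨R, hR0⟩, LipschitzWith.of_le_add_mul _ ?_⟩
  intro a b
  refine ciSup_le fun y => ?_
  have h1 : inner ℝ (polarDir a) (y : Plane)
      = inner ℝ (polarDir b) (y : Plane) + inner ℝ (polarDir a - polarDir b) (y : Plane) := by
    rw [inner_sub_left]; ring
  have h2 : inner ℝ (polarDir a - polarDir b) (y : Plane) ≤ dist a b * R := by
    refine (real_inner_le_norm _ _).trans ?_
    have := lipschitz_polarDir.dist_le_mul a b
    rw [dist_eq_norm] at this
    simp only [NNReal.coe_one, one_mul] at this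
    exact mul_le_mul this (hR _ y.2) (norm_nonneg _) dist_nonneg
  have h3 := le_ciSup (bdd b) y
  change _ ≤ _ + R * dist a b
  linarith

/-- Almost every direction is normal to `E` at no more than one point. -/
theorem multiNormals_null {E : Set Plane} (hE : Bornology.IsBounded E) :
    μH[1] (multiNormals E) = 0 := by
  rcases E.eq_empty_or_nonempty with rfl | hne
  · simp [multiNormals]
  obtain ⟨K, hK⟩ := lipschitz_support hE hne
  have := hne.to_subtype
  set s : ℝ → ℝ := fun θ => ⨆ y : E, inner ℝ (polarDir θ) (y : Plane) with hs
  obtain ⟨R, hR⟩ := hE.exists_norm_le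
  have bdd : ∀ θ, BddAbove (range fun y : E => inner ℝ (polarDir θ) (y : Plane)) := by
    intro θ
    refine ⟨R, ?_⟩
    rintro _ ⟨y, rfl⟩
    refine (real_inner_le_norm _ _).trans ?_
    rw [norm_polarDir, one_mul]
    exact hR _ y.2
  have hle : ∀ θ, ∀ x ∈ closure E, inner ℝ (polarDir θ) x ≤ s θ := by
    intro θ x hx
    have hcl : IsClosed {x : Plane | inner ℝ (polarDir θ) x ≤ s θ} :=
      isClosed_le (by fun_prop) continuous_const
    exact closure_minimal (fun y hy => le_ciSup (bdd θ) (⟨y, hy⟩ : E)) hcl hx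
  have hnull : μH[1] {θ : ℝ | ¬ DifferentiableAt ℝ s θ} = 0 := by
    rw [hausdorffMeasure_real]
    exact hK.ae_differentiableAt_real
  have himg : μH[1] (polarDir '' {θ : ℝ | ¬ DifferentiableAt ℝ s θ}) = 0 := by
    have h := lipschitz_polarDir.hausdorffMeasure_image_le (d := 1) zero_le_one
      {θ : ℝ | ¬ DifferentiableAt ℝ s θ}
    rw [hnull, mul_zero] at h
    exact le_antisymm h zero_le
  refine measure_mono_null ?_ himg
  rintro u ⟨hu, x, hx, x', hx', hxx, hn, hn'⟩
  obtain ⟨θ, rfl⟩ := exists_polarDir hu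
  refine ⟨θ, ?_, rfl⟩
  intro hd
  apply hxx
  have key : ∀ z ∈ frontier E, (∀ y ∈ E, inner ℝ (polarDir θ) (y - z) ≤ 0) →
      inner ℝ (polarDir θ) z = s θ ∧
        inner ℝ (!₂[-Real.sin θ, Real.cos θ] : Plane) z = deriv s θ := by
    intro z hz hnz
    have hzc : z ∈ closure E := frontier_subset_closure hz
    have heq : inner ℝ (polarDir θ) z = s θ := by
      refine le_antisymm (hle θ z hzc) (ciSup_le fun y => ?_)
      have := hnz y y.2
      rw [inner_sub_right] at this
      linarith
    refine ⟨heq, ?_⟩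
    have hder : HasDerivAt (fun t => inner ℝ (polarDir t) z)
        (inner ℝ (!₂[-Real.sin θ, Real.cos θ] : Plane) z) θ := by
      simpa using (hasDerivAt_polarDir θ).inner ℝ (hasDerivAt_const θ z)
    have hmin : IsLocalMin (fun t => s t - inner ℝ (polarDir t) z) θ := by
      refine Filter.Eventually.of_forall fun t => ?_
      have := hle t z hzc
      change s θ - inner ℝ (polarDir θ) z ≤ s t - inner ℝ (polarDir t) z
      linarith
    have := hmin.hasDerivAt_eq_zero (hd.hasDerivAt.sub hder)
    linarith
  obtain ⟨a1, a2⟩ := key x hx hn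
  obtain ⟨b1, b2⟩ := key x' hx' hn'
  rw [← b1] at a1
  rw [← b2] at a2
  rw [inner_polarDir, inner_polarDir] at a1
  simp only [PiLp.inner_apply, Fin.sum_univ_two] at a2
  simp at a2
  have hcs := Real.sin_sq_add_cos_sq θ
  ext i
  fin_cases i
  · change x 0 = x' 0
    linear_combination Real.cos θ * a1 - Real.sin θ * a2 - (x 0 - x' 0) * hcs
  · change x 1 = x' 1
    linear_combination Real.sin θ * a1 + Real.cos θ * a2 - (x 1 - x' 1) * hcs

theorem gaussImage_inter_subset (E : Set Plane) {β β' : Set Plane} (h : Disjoint β β') :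
    gaussImage E β ∩ gaussImage E β' ⊆ multiNormals E := by
  rintro u ⟨⟨hu, x, hx, hn⟩, ⟨_, x', hx', hn'⟩⟩
  refine ⟨hu, x, hx.2, x', hx'.2, ?_, hn, hn'⟩
  rintro rfl
  exact Set.disjoint_left.1 h hx.1 hx'.1

theorem gaussImage_iUnion (E : Set Plane) (β : ℕ → Set Plane) :
    gaussImage E (⋃ i, β i) = ⋃ i, gaussImage E (β i) := by
  ext u
  simp only [gaussImage, mem_ofPred_eq, mem_iUnion, mem_inter_iff]
  constructor
  · rintro ⟨hu, x, ⟨⟨i, hi⟩, hx⟩, hn⟩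
    exact ⟨i, hu, x, ⟨hi, hx⟩, hn⟩
  · rintro ⟨i, hu, x, ⟨hi, hx⟩, hn⟩
    exact ⟨hu, x, ⟨⟨i, hi⟩, hx⟩, hn⟩

theorem gaussImage_compl (E β : Set Plane) :
    gaussImage E βᶜ = (gaussImage E univ \ gaussImage E β) ∪
      (gaussImage E β ∩ gaussImage E βᶜ) := by
  ext u
  constructor
  · intro h
    by_cases hb : u ∈ gaussImage E β
    · exact Or.inr ⟨hb, h⟩
    · obtain ⟨hu, x, hx, hn⟩ := h
      exact Or.inl ⟨⟨hu, x, ⟨mem_univ _, hx.2⟩, hn⟩, hb⟩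
  · rintro (⟨⟨hu, x, hx, hn⟩, hb⟩ | h)
    · refine ⟨hu, x, ⟨fun hxb => hb ⟨hu, x, ⟨hxb, hx.2⟩, hn⟩, hx.2⟩, hn⟩
    · exact h.2

theorem isCompact_gaussImage {E β : Set Plane} (hE : Bornology.IsBounded E) (hβ : IsClosed β) :
    IsCompact (gaussImage E β) := by
  have hfr : IsCompact (β ∩ frontier E) :=
    ((isCompact_of_isClosed_isBounded isClosed_closure hE.closure).of_isClosed_subset
      isClosed_frontier frontier_subset_closure).inter_left hβ
  have hc : IsCompact ((sphere (0 : Plane) 1 ×ˢ (β ∩ frontier E)) ∩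
      {p : Plane × Plane | ∀ y ∈ E, inner ℝ p.1 (y - p.2) ≤ 0}) := by
    refine ((isCompact_sphere _ _).prod hfr).inter_right ?_
    simp only [ofPred_forall]
    exact isClosed_biInter fun y _ => isClosed_le (by fun_prop) continuous_const
  convert hc.image continuous_fst using 1
  ext u
  simp only [gaussImage, mem_ofPred_eq, mem_image, mem_inter_iff, mem_prod, mem_sphere_zero_iff_norm,
    Prod.exists, exists_and_right, exists_eq_right]
  constructor
  · rintro ⟨hu, x, hx, hn⟩
    exact ⟨x, ⟨hu, hx⟩, hn⟩
  · rintro ⟨x, ⟨hu, hx⟩, hn⟩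
    exact ⟨hu, x, hx, hn⟩

theorem nullMeasurableSet_gaussImage {E : Set Plane} (hE : Bornology.IsBounded E) {β : Set Plane}
    (hβ : MeasurableSet β) : NullMeasurableSet (gaussImage E β) (μH[1] : Measure Plane) := by
  have hcompl : ∀ b : Set Plane, NullMeasurableSet (gaussImage E b) (μH[1] : Measure Plane) →
      NullMeasurableSet (gaussImage E bᶜ) (μH[1] : Measure Plane) := by
    intro b hb
    rw [gaussImage_compl]
    refine NullMeasurableSet.union (NullMeasurableSet.diff ?_ hb) (NullMeasurableSet.of_null ?_)
    · exact (isCompact_gaussImage hE isClosed_univ).measurableSet.nullMeasurableSet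
    · exact measure_mono_null (gaussImage_inter_subset E disjoint_compl_right)
        (multiNormals_null hE)
  induction β, hβ using MeasurableSet.induction_on_open with
  | isOpen U hU =>
    rw [← compl_compl U]
    exact hcompl _ (isCompact_gaussImage hE hU.isClosed_compl).measurableSet.nullMeasurableSet
  | compl t _ ih => exact hcompl t ih
  | iUnion g _ _ ih =>
    rw [gaussImage_iUnion]
    exact NullMeasurableSet.iUnion ih

open Classical in
/-- The curvature measure `μ_E` of a bounded convex set `E` in the plane (its curvature measure of
order zero): `μ_E(β)` is the length of the set of outer unit normals of `E` at the boundary points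
of `E` in `β`, for every Borel set `β`. For `E` of class `C²` it is `H_{∂E}` times the arc length
of `∂E`. It is set to zero if `E` is not convex or not bounded. -/
noncomputable def curvatureMeasure (E : Set Plane) : Measure Plane :=
  if hE : Convex ℝ E ∧ Bornology.IsBounded E then
    Measure.ofMeasurable (fun β _ => μH[1] (gaussImage E β))
      (by simp [gaussImage])
      (by
        intro β hβ hd
        rw [gaussImage_iUnion]
        refine measure_iUnion₀ (fun i j hij => ?_)
          (fun i => nullMeasurableSet_gaussImage hE.2 (hβ i))
        exact measure_mono_null (gaussImage_inter_subset E (hd hij)) (multiNormals_null hE.2))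
  else 0

theorem curvatureMeasure_apply {E β : Set Plane} (hc : Convex ℝ E) (hE : Bornology.IsBounded E)
    (hβ : MeasurableSet β) : curvatureMeasure E β = μH[1] (gaussImage E β) := by
  rw [curvatureMeasure, dif_pos ⟨hc, hE⟩, Measure.ofMeasurable_apply _ hβ]

/-- The signed distance from `∂E`, negative inside `E`. -/
noncomputable def signedBoundaryDist (E : Set Plane) (x : Plane) : ℝ :=
  infDist x E - infDist x Eᶜ

/-- The exterior unit normal of a `C²` set `E`, extended to a neighbourhood of `∂E` as the gradient
of the signed distance. -/
noncomputable def exteriorNormal (E : Set Plane) (x : Plane) : Plane :=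
  gradient (signedBoundaryDist E) x

/-- The tangential divergence `div X - ⟨DX ν, ν⟩` along `∂E` of a vector field `X` defined in a
neighbourhood of `∂E`. -/
noncomputable def tangentialDiv (E : Set Plane) (X : Plane → Plane) (x : Plane) : ℝ :=
  LinearMap.trace ℝ Plane (fderiv ℝ X x).toLinearMap
    - inner ℝ (fderiv ℝ X x (exteriorNormal E x)) (exteriorNormal E x)

/-- The mean curvature `H_{∂E} = div_τ ν` of the boundary of a `C²` set `E`. -/
noncomputable def meanCurvature (E : Set Plane) (x : Plane) : ℝ :=
  tangentialDiv E (exteriorNormal E) x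

/-! Total curvature does not depend on the set: every unit vector is an outer normal somewhere
(`gaussImage_frontier`), so `μ_E(∂E)` is the length of the unit circle, and so is the integral of
the curvature `1/r` over `∂B_r`. The two integrals therefore differ by the integral of `f(|x|) -
f(r)` against `μ_E`. Since `f` is Lipschitz near `r`, it remains to bound `||x| - r|` on `∂E` by the
Hausdorff distance; this is where convexity matters (`abs_norm_sub_le_hausdorffDist`). -/

/-! ### Curvature of the circle. -/

theorem dist_radial_projection {r : ℝ} {x : Plane} (hx : x ≠ 0) :
    dist x ((r / ‖x‖) • x) = |‖x‖ - r| := by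
  have hx' : 0 < ‖x‖ := norm_pos_iff.2 hx
  have h : x - (r / ‖x‖) • x = ((‖x‖ - r) / ‖x‖) • x := by
    rw [sub_div, div_self hx'.ne', sub_smul, one_smul]
  rw [dist_eq_norm, h, norm_smul, Real.norm_eq_abs, abs_div, abs_of_pos hx',
    div_mul_cancel₀ _ hx'.ne']

theorem norm_radial_projection {r : ℝ} (hr : 0 ≤ r) {x : Plane} (hx : x ≠ 0) :
    ‖(r / ‖x‖) • x‖ = r := by
  have hx' : 0 < ‖x‖ := norm_pos_iff.2 hx
  rw [norm_smul, Real.norm_eq_abs, abs_of_nonneg (by positivity), div_mul_cancel₀ _ hx'.ne']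

/-- The radial projection attains the distance to the circle from either side; the reverse triangle
inequality shows that nothing is nearer. -/
theorem signedBoundaryDist_ball {r : ℝ} (hr : 0 < r) {x : Plane} (hx : x ≠ 0) :
    signedBoundaryDist (ball 0 r) x = ‖x‖ - r := by
  rw [signedBoundaryDist]
  rcases le_or_gt r ‖x‖ with h | h
  · have h0 : infDist x (ball (0 : Plane) r)ᶜ = 0 := infDist_zero_of_mem (by simpa using h)
    have h1 : infDist x (ball (0 : Plane) r) = ‖x‖ - r := by
      rw [← infDist_closure, closure_ball _ hr.ne']
      apply le_antisymm
      · rw [← abs_of_nonneg (sub_nonneg.2 h), ← dist_radial_projection hx]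
        exact infDist_le_dist_of_mem (by simp [norm_radial_projection hr.le hx])
      · refine (le_infDist ⟨0, by simp [hr.le]⟩).2 fun y hy => ?_
        have hy' : ‖y‖ ≤ r := by simpa using hy
        rw [dist_eq_norm]
        linarith [norm_sub_norm_le x y]
    rw [h0, h1, sub_zero]
  · have h0 : infDist x (ball (0 : Plane) r) = 0 := infDist_zero_of_mem (by simpa using h)
    have h1 : infDist x (ball (0 : Plane) r)ᶜ = r - ‖x‖ := by
      have hmem : (r / ‖x‖) • x ∈ (ball (0 : Plane) r)ᶜ := by
        simp [norm_radial_projection hr.le hx]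
      apply le_antisymm
      · rw [← neg_sub, ← abs_of_neg (sub_neg.2 h), ← dist_radial_projection hx]
        exact infDist_le_dist_of_mem hmem
      · refine (le_infDist ⟨_, hmem⟩).2 fun y hy => ?_
        have hy' : r ≤ ‖y‖ := by simpa using hy
        rw [dist_comm, dist_eq_norm]
        linarith [norm_sub_norm_le y x]
    rw [h0, h1]
    ring

theorem hasFDerivAt_norm_plane {x : Plane} (hx : x ≠ 0) :
    HasFDerivAt (fun y : Plane => ‖y‖) (‖x‖⁻¹ • innerSL ℝ x) x := by
  have hx' : 0 < ‖x‖ := norm_pos_iff.2 hx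
  have h := (hasStrictFDerivAt_norm_sq x).hasFDerivAt.sqrt (by positivity)
  simp only [Real.sqrt_sq (norm_nonneg _)] at h
  refine h.congr_fderiv ?_
  ext y
  simp only [smul_apply, nsmul_eq_mul, smul_eq_mul]
  field_simp
  norm_num

theorem exteriorNormal_ball {r : ℝ} (hr : 0 < r) {x : Plane} (hx : x ≠ 0) :
    exteriorNormal (ball 0 r) x = ‖x‖⁻¹ • x := by
  have h : HasGradientAt (fun y : Plane => ‖y‖ - r) (‖x‖⁻¹ • x) x := by
    rw [hasGradientAt_iff_hasFDerivAt]
    refine ((hasFDerivAt_norm_plane hx).sub_const r).congr_fderiv ?_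
    ext y
    simp
  have he : signedBoundaryDist (ball 0 r) =ᶠ[𝓝 x] fun y => ‖y‖ - r :=
    (eventually_ne_nhds hx).mono fun y hy => signedBoundaryDist_ball hr hy
  exact (h.congr_of_eventuallyEq he).gradient

/-- The normal field is `x / |x|`. Its divergence is `2/r - 1/r`, and the normal correction vanishes
because the field is constant along rays. -/
theorem meanCurvature_ball {r : ℝ} (hr : 0 < r) {x : Plane} (hx : ‖x‖ = r) :
    meanCurvature (ball 0 r) x = r⁻¹ := by
  have hx0 : x ≠ 0 := norm_pos_iff.1 (hx ▸ hr)
  have he : exteriorNormal (ball 0 r) =ᶠ[𝓝 x] fun y => ‖y‖⁻¹ • y :=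
    (eventually_ne_nhds hx0).mono fun y hy => exteriorNormal_ball hr hy
  have hinv : HasFDerivAt (fun y : Plane => ‖y‖⁻¹) (-(‖x‖ ^ 2)⁻¹ • (‖x‖⁻¹ • innerSL ℝ x)) x :=
    (hasDerivAt_inv (norm_ne_zero_iff.2 hx0)).comp_hasFDerivAt x (hasFDerivAt_norm_plane hx0)
  have hd := (hinv.smul (hasFDerivAt_id x)).congr_of_eventuallyEq he
  rw [meanCurvature, tangentialDiv, hd.fderiv, exteriorNormal_ball hr hx0]
  have htr : ∀ (a : ℝ) (g : Plane →L[ℝ] ℝ), LinearMap.trace ℝ Plane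
      (a • ContinuousLinearMap.id ℝ Plane + g.smulRight x).toLinearMap = 2 * a + g x := by
    intro a g
    have : (a • ContinuousLinearMap.id ℝ Plane + g.smulRight x).toLinearMap
        = a • LinearMap.id + g.toLinearMap.smulRight x := rfl
    rw [this, map_add, map_smul, LinearMap.trace_id, LinearMap.trace_smulRight]
    simp [mul_comm]
  simp only [id]
  rw [htr]
  simp [inner_smul_left, inner_smul_right, inner_add_left, hx]
  field_simp
  ring

/-! ### Total curvature. -/

-- The scaling factor `r` will cancel the curvature `1/r`, so the length of the unit circle need
-- only be finite, not computed.
open scoped Pointwise in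
theorem hausdorffMeasure_sphere {r : ℝ} (hr : 0 < r) :
    μH[1] (sphere (0 : Plane) r) = ENNReal.ofReal r * μH[1] (sphere (0 : Plane) 1) := by
  have h : sphere (0 : Plane) r = r • sphere (0 : Plane) 1 := by
    rw [smul_sphere' hr.ne', smul_zero, Real.norm_of_nonneg hr.le, mul_one]
  rw [h, Measure.hausdorffMeasure_smul₀ zero_le_one hr.ne', NNReal.rpow_one, ENNReal.smul_def,
    smul_eq_mul, Real.nnnorm_of_nonneg hr.le, ENNReal.ofReal_eq_coe_nnreal hr.le]

theorem hausdorffMeasure_unit_sphere_lt_top : μH[1] (sphere (0 : Plane) 1) < ⊤ := by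
  have hsub : sphere (0 : Plane) 1 ⊆ polarDir '' Icc 0 (2 * Real.pi) := by
    intro u hu
    obtain ⟨θ, rfl⟩ := exists_polarDir (by simpa using hu)
    have hper : Function.Periodic polarDir (2 * Real.pi) := fun t => by simp [polarDir]
    obtain ⟨t, ht, he⟩ := hper.exists_mem_Ico₀ Real.two_pi_pos θ
    exact ⟨t, Ico_subset_Icc_self ht, he.symm⟩
  refine (measure_mono hsub).trans_lt
    ((lipschitz_polarDir.hausdorffMeasure_image_le (d := 1) zero_le_one _).trans_lt ?_)
  rw [hausdorffMeasure_real, Real.volume_Icc]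
  exact ENNReal.mul_lt_top (by simp) ENNReal.ofReal_lt_top

/-- For each unit `u`, the functional `⟨u, ·⟩` has a maximizer on the compact closure. It is not
interior, since moving along `u` would increase the value, so `u` is a normal there. -/
theorem gaussImage_frontier {E : Set Plane} (hE : Bornology.IsBounded E) (hne : E.Nonempty) :
    gaussImage E (frontier E) = sphere 0 1 := by
  ext u
  refine ⟨fun h => by simpa using h.1, fun h => ?_⟩
  have hu : ‖u‖ = 1 := by simpa using h
  have hc : IsCompact (closure E) := hE.isCompact_closure
  obtain ⟨x, hx, hmax⟩ := hc.exists_isMaxOn hne.closure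
    (f := fun y : Plane => inner ℝ u y) (by fun_prop)
  have hmax' : ∀ y ∈ closure E, inner ℝ u y ≤ inner ℝ u x := fun y hy => hmax hy
  have hxf : x ∈ frontier E := by
    refine ⟨hx, fun hi => ?_⟩
    have hcont : Tendsto (fun t : ℝ => x + t • u) (𝓝[>] 0) (𝓝 x) := by
      have : Continuous fun t : ℝ => x + t • u := by fun_prop
      simpa using (this.tendsto 0).mono_left nhdsWithin_le_nhds
    obtain ⟨t, ht, ht0⟩ := ((hcont.eventually (mem_interior_iff_mem_nhds.1 hi)).and
      self_mem_nhdsWithin).exists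
    have := hmax' _ (subset_closure ht)
    rw [inner_add_right, inner_smul_right, real_inner_self_eq_norm_sq, hu] at this
    have : 0 < t := ht0
    linarith
  refine ⟨hu, x, ⟨hxf, hxf⟩, fun y hy => ?_⟩
  rw [inner_sub_right]
  linarith [hmax' y (subset_closure hy)]

/-! ### Boundary of a convex set close to the disk. -/

/-- A convex planar set within Hausdorff distance `ε` of the disk of radius `r` has a closure
containing the concentric disk of radius `r - ε`. -/
theorem ball_subset_closure_of_hausdorffDist {E : Set Plane} {r : ℝ} (hc : Convex ℝ E)
    (hfin : hausdorffEDist E (ball 0 r) ≠ ⊤) :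
    ball 0 (r - hausdorffDist E (ball 0 r)) ⊆ closure E := by
  intro y hy
  set ε := hausdorffDist E (ball (0 : Plane) r)
  have hy' : ‖y‖ < r - ε := by simpa using hy
  have hε : 0 ≤ ε := hausdorffDist_nonneg
  by_contra hyE
  obtain ⟨g, a, hg, hga⟩ := geometric_hahn_banach_closed_point hc.closure isClosed_closure hyE
  obtain ⟨v, rfl⟩ := (InnerProductSpace.toDual ℝ Plane).surjective g
  simp only [InnerProductSpace.toDual_apply_apply] at hg hga
  -- The point at radius `s < r` in the separating direction `v` lies in the disk, and `s - ‖y‖ >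
  -- ε`, so some `q ∈ E` is closer to it than `s - ‖y‖`. Then `⟨v, q⟩ > ‖v‖ ‖y‖ ≥ ⟨v, y⟩`, against
  -- the separation.
  obtain ⟨s, hs1, hs2⟩ := exists_between (show ε + ‖y‖ < r by linarith)
  have hs0 : 0 < s := by linarith [norm_nonneg y]
  have hball : ∀ p : Plane, ‖p‖ < r → ∃ q ∈ E, dist q p < s - ‖y‖ := fun p hp =>
    exists_dist_lt_of_hausdorffDist_lt' (by simpa using hp)
      (show hausdorffDist E (ball (0 : Plane) r) < s - ‖y‖ by change ε < _; linarith) hfin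
  have hv : 0 < ‖v‖ := by
    rw [norm_pos_iff]
    rintro rfl
    obtain ⟨q, hq, -⟩ := hball 0 (by simpa using hs0.trans hs2)
    have := hg q (subset_closure hq)
    simp only [inner_zero_left] at this hga
    linarith
  obtain ⟨q, hq, hd⟩ := hball ((s / ‖v‖) • v)
    (by rwa [norm_radial_projection hs0.le (norm_pos_iff.1 hv)])
  have h1 := hg q (subset_closure hq)
  have h2 : inner ℝ v ((s / ‖v‖) • v) = s * ‖v‖ := by
    rw [inner_smul_right, real_inner_self_eq_norm_sq]
    field_simp
  have h3 := real_inner_le_norm v ((s / ‖v‖) • v - q)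
  rw [inner_sub_right, h2, ← dist_eq_norm, dist_comm] at h3
  have h4 := real_inner_le_norm v y
  have h5 := mul_lt_mul_of_pos_left hd hv
  linarith

/-- Needed because `E` need not be closed. If the closure has interior, it spans the plane; affine
subspaces are closed, so `E` spans too and, being convex, has interior itself. -/
theorem Convex.interior_closure_subset_interior {E : Set Plane} (hc : Convex ℝ E) :
    interior (closure E) ⊆ interior E := by
  rcases (interior (closure E)).eq_empty_or_nonempty with h | h
  · simp [h]
  have hspan : affineSpan ℝ E = ⊤ := by
    have h1 := hc.closure.interior_nonempty_iff_affineSpan_eq_top.1 h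
    have h2 : closure E ⊆ affineSpan ℝ E :=
      closure_minimal (subset_affineSpan ℝ E) (AffineSubspace.closed_of_finiteDimensional _)
    rw [eq_top_iff, ← h1]
    exact affineSpan_le.2 h2
  exact (hc.interior_closure_eq_interior_of_nonempty_interior
    (hc.interior_nonempty_iff_affineSpan_eq_top.2 hspan)).subset

/-- A boundary point too near the origin would lie in an open disk inside the closure, hence in the
interior. The upper bound does not use convexity. Finiteness is required because `hausdorffDist` is
`0` when the extended distance is `⊤`. -/
theorem abs_norm_sub_le_hausdorffDist {E : Set Plane} {r : ℝ} (hc : Convex ℝ E)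
    (hfin : hausdorffEDist E (ball 0 r) ≠ ⊤) {x : Plane} (hx : x ∈ frontier E) :
    |‖x‖ - r| ≤ hausdorffDist E (ball 0 r) := by
  rw [abs_le]
  constructor
  · by_contra! h
    refine hx.2 (hc.interior_closure_subset_interior ?_)
    refine interior_maximal (ball_subset_closure_of_hausdorffDist hc hfin) isOpen_ball ?_
    rw [mem_ball_zero_iff]
    linarith
  · have hE : E ⊆ closedBall 0 (r + hausdorffDist E (ball 0 r)) := by
      intro y hy
      rw [mem_closedBall_zero_iff]
      refine le_of_forall_pos_le_add fun δ hδ => ?_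
      obtain ⟨z, hz, hd⟩ := exists_dist_lt_of_hausdorffDist_lt hy (lt_add_of_pos_right _ hδ) hfin
      rw [mem_ball_zero_iff] at hz
      rw [dist_eq_norm] at hd
      linarith [norm_sub_norm_le y z]
    have := closure_minimal hE isClosed_closedBall hx.1
    rw [mem_closedBall_zero_iff] at this
    linarith

theorem isBounded_of_hausdorffEDist {E : Set Plane} {r : ℝ}
    (hfin : hausdorffEDist E (ball 0 r) ≠ ⊤) : Bornology.IsBounded E := by
  refine (isBounded_ball (x := (0 : Plane)) (r := r)).thickening
    (δ := hausdorffDist E (ball 0 r) + 1) |>.subset fun y hy => mem_thickening_iff.2 ?_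
  exact exists_dist_lt_of_hausdorffDist_lt hy (lt_add_one _) hfin

/-! ### Comparison of the integrals. -/

theorem setIntegral_mul_meanCurvature_ball {r : ℝ} (hr : 0 < r) (f : ℝ → ℝ) :
    ∫ x in frontier (ball (0 : Plane) r), f ‖x‖ * meanCurvature (ball (0 : Plane) r) x ∂μH[1]
      = (μH[1] : Measure Plane).real (sphere 0 1) * f r := by
  rw [frontier_ball _ hr.ne']
  have h : ∀ x ∈ sphere (0 : Plane) r, f ‖x‖ * meanCurvature (ball (0 : Plane) r) x
      = f r * r⁻¹ := fun x hx => by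
    rw [mem_sphere_zero_iff_norm] at hx
    rw [meanCurvature_ball hr hx, hx]
  rw [setIntegral_congr_fun isClosed_sphere.measurableSet h, setIntegral_const, smul_eq_mul,
    measureReal_def, hausdorffMeasure_sphere hr, ENNReal.toReal_mul, ENNReal.toReal_ofReal hr.le,
    measureReal_def]
  field_simp

theorem mainTheorem3 (r : ℝ) (hr : 0 < r) (f : ℝ → ℝ)
    (hf : ContDiffOn ℝ 1 f (Set.Ici 0))
    (hpos : ∀ t ∈ Set.Ici (0 : ℝ), 0 < f t)
    (hanti : AntitoneOn f (Set.Ici 0)) :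
    ∃ C : ℝ, ∀ E : ℕ → Set Plane,
      (∀ h, Convex ℝ (E h)) →
      Tendsto (fun h => hausdorffEDist (E h) (ball (0 : Plane) r)) atTop (𝓝 0) →
      ∀ᶠ h in atTop,
        IntegrableOn (fun x : Plane => f ‖x‖) (frontier (E h)) (curvatureMeasure (E h)) ∧
        |(∫ x in frontier (E h), f ‖x‖ ∂(curvatureMeasure (E h)))
            - ∫ x in frontier (ball (0 : Plane) r),
                f ‖x‖ * meanCurvature (ball (0 : Plane) r) x ∂μH[1]|
          ≤ C * hausdorffDist (E h) (ball (0 : Plane) r) := by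
  -- Once the Hausdorff distance is at most `r`, all boundary points have norm in `[0, 2r]`, so `K`
  -- depends only on `r` and `f`.
  obtain ⟨K, hK⟩ := (hf.mono (Icc_subset_Ici_self : Icc 0 (2 * r) ⊆ Ici 0)).exists_lipschitzOnWith
    one_ne_zero (convex_Icc _ _) isCompact_Icc
  refine ⟨K * (μH[1] : Measure Plane).real (sphere 0 1), fun E hE hlim => ?_⟩
  filter_upwards [hlim.eventually_lt_const (ENNReal.ofReal_pos.2 hr)] with h hlt
  have hfin : hausdorffEDist (E h) (ball 0 r) ≠ ⊤ := hlt.ne_top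
  have hle : hausdorffDist (E h) (ball 0 r) ≤ r :=
    ENNReal.toReal_le_of_le_ofReal hr.le hlt.le
  have hbdd := isBounded_of_hausdorffEDist hfin
  have hne : (E h).Nonempty :=
    nonempty_of_hausdorffEDist_ne_top ⟨0, mem_ball_self hr⟩ (by rwa [hausdorffEDist_comm])
  have hμ : curvatureMeasure (E h) (frontier (E h)) = μH[1] (sphere (0 : Plane) 1) := by
    rw [curvatureMeasure_apply (hE h) hbdd isClosed_frontier.measurableSet,
      gaussImage_frontier hbdd hne]
  have hμtop : curvatureMeasure (E h) (frontier (E h)) < ⊤ :=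
    hμ ▸ hausdorffMeasure_unit_sphere_lt_top
  have hcont : Continuous fun x : Plane => f ‖x‖ :=
    hf.continuousOn.comp_continuous continuous_norm fun x => norm_nonneg x
  have hest : ∀ x ∈ frontier (E h), ‖f ‖x‖ - f r‖ ≤ K * hausdorffDist (E h) (ball 0 r) := by
    intro x hx
    have hxr := abs_norm_sub_le_hausdorffDist (hE h) hfin hx
    have hx2 : ‖x‖ ∈ Icc 0 (2 * r) :=
      ⟨norm_nonneg x, by linarith [(abs_le.1 hxr).2]⟩
    have := hK.dist_le_mul ‖x‖ hx2 r ⟨hr.le, by linarith⟩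
    rw [dist_eq_norm, Real.dist_eq] at this
    exact this.trans (by gcongr)
  have hdiff : IntegrableOn (fun x : Plane => f ‖x‖ - f r) (frontier (E h))
      (curvatureMeasure (E h)) :=
    Measure.integrableOn_of_bounded hμtop.ne
      (hcont.sub continuous_const).aestronglyMeasurable
      ((ae_restrict_iff' isClosed_frontier.measurableSet).2 (Eventually.of_forall hest))
  have hconst : IntegrableOn (fun _ : Plane => f r) (frontier (E h)) (curvatureMeasure (E h)) :=
    integrableOn_const hμtop.ne
  have hint : IntegrableOn (fun x : Plane => f ‖x‖) (frontier (E h)) (curvatureMeasure (E h)) := by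
    refine (hdiff.add hconst).congr_fun (fun x _ => ?_) isClosed_frontier.measurableSet
    simp
  refine ⟨hint, ?_⟩
  have hreal : (curvatureMeasure (E h)).real (frontier (E h))
      = (μH[1] : Measure Plane).real (sphere 0 1) := by
    rw [measureReal_def, hμ, measureReal_def]
  -- Equality of total masses makes the integral over the circle equal to that of the constant `f r`
  -- against `μ_E`.
  have hsub := integral_sub hint hconst
  rw [setIntegral_const, hreal, smul_eq_mul] at hsub
  rw [setIntegral_mul_meanCurvature_ball hr, ← hsub]
  have := norm_setIntegral_le_of_norm_le_const hμtop hest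
  rw [hreal, Real.norm_eq_abs] at this
  linarith
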